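/- Assume $2^{\omega_1}=\omega_2$. Fix a bijection $\pi:\omega_2\to H(\omega_2)$ and a stationary set $\mathcal Y\subseteq P_{\omega_1}(\omega_2)$ (a set of countable subsets of $\omega_2$) which is thin, i.e. $\{a\cap\beta : a\in\mathcal Y\}$ has size at most $\omega_1$ for every $\beta<\omega_2$, and which is closed under initial segments, i.e. $a\cap\beta\in\mathcal Y$ whenever $a\in\mathcal Y$ and $\beta<\omega_2$. Let $\mathcal A=(H(\omega_2),\in,\pi,\mathcal Y)$, fix a set of definable Skolem functions for $\mathcal A$, one for each formula, and let $Sk(a)$ denote the closure of $a$ under them. Let $C=\{\beta<\omega_2 : Sk(\beta)\cap\omega_2=\beta\}$, let $\Lambda$ be the set of $\beta<\omega_2$ of cofinality $\omega_1$ which are limit points of $C$, and let $\mathcal X$ be the set of $M\in\mathcal Y$ such that $Sk(M)\cap\omega_2=M$ and $\sup(C\cap\gamma)\in M$ for all $\gamma\in M$. Fix a set $\Gamma\subseteq\Lambda$ which is stationary in $\omega_2$. For $M\in\mathcal X$ let $\Gamma_M=\{\beta\in\Gamma : \beta=\min(\Gamma\setminus\sup(M\cap\beta))\}$, and for $M,N\in\mathcal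 X$ let $\beta_{M,N}=\max(\Gamma_M\cap\Gamma_N)$. A set $A\subseteq\mathcal X$ is adequate if for all $M,N\in A$, either $M\cap\beta_{M,N}=N\cap\beta_{M,N}$, or $M\cap\beta_{M,N}\in Sk(N)$, or $N\cap\beta_{M,N}\in Sk(M)$. A finite tree on $\omega_1$ is a pair $T=(|T|,<_T)$, where $|T|$ is a finite subset of $\omega_1$ and $<_T$ is an irreflexive transitive relation on $|T|$ such that any two elements of $|T|$ lying $<_T$-below a common element are equal or $<_T$-comparable, and $a<_T b$ implies $a<b$. A finite tree $U$ end-extends $T$ if $|T|\subseteq|U|$ and $<_U\cap\,(|T|\times|T|)=\,<_T$. Let $\mathbb P$ be the forcing poset of all triples $(T,F,A)$ such that: (1) $T$ is a finite tree on $\omega_1$; (2) $F$ is an injective function from the set of maximal nodes of $T$ into $\omega_2$; (3) $A$ is a finite adequate set; (4) if $M\in A$, $a$ and $b$ are distinct maximal nodes of $T$, and $F(a),F(b)\in M$, then every $c$ with $c<_T a$ and $c<_T b$ is in $M$. Order $\mathbb P$ by letting $(U,G,B)\le(T,F,A)$ if $U$ end-extends $T$, $A\subseteq B$, and for every maximal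 node $a$ of $T$ there is a maximal node $b$ of $U$ with $a\le_U b$ and $F(a)=G(b)$. Then $\mathbb P$ is $\omega_2$-c.c.: every set of pairwise incompatible conditions in $\mathbb P$ has cardinality less than $\omega_2$. -/

import Mathlib

open scoped Cardinal Ordinal

namespace AdequateKurepa

/-- `H(ω₂)`: the sets whose transitive closure has cardinality less than `ℵ₂`
(equivalently, the sets included in some transitive set of cardinality less than `ℵ₂`). -/
def HOmega2 : Set ZFSet.{0} :=
  {x | ∃ t : ZFSet.{0}, t.IsTransitive ∧ x ⊆ t ∧ t.card < ℵ_ 2}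

/-- The ordinals below `ω₂`, as a type. -/
abbrev Omega2 : Type 1 := Set.Iio (ω_ 2 : Ordinal.{0})

/-- A set of ordinals below `ω₂`, as an element of the universe of sets
(ordinals are identified with von Neumann ordinals). -/
noncomputable def setCode (a : Set Ordinal.{0}) : ZFSet.{0} :=
  ZFSet.sep (fun x => ∃ α ∈ a, α.toZFSet = x) (ω_ 2 : Ordinal.{0}).toZFSet

/-- `P_{ω₁}(ω₂)`: the countable subsets of `ω₂`. -/
def POmega1 : Set (Set Ordinal.{0}) :=
  {a | a ⊆ Set.Iio (ω_ 2) ∧ a.Countable}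

/-- Club subsets of `P_{ω₁}(ω₂)`: cofinal, and closed under unions of increasing `ω`-chains. -/
structure IsClubPOmega1 (E : Set (Set Ordinal.{0})) : Prop where
  subset : E ⊆ POmega1
  cofinal : ∀ a ∈ POmega1, ∃ b ∈ E, a ⊆ b
  closed : ∀ f : ℕ → Set Ordinal.{0}, Monotone f → (∀ n, f n ∈ E) → (⋃ n, f n) ∈ E

/-- Stationary subsets of `P_{ω₁}(ω₂)`. -/
def IsStationaryPOmega1 (Y : Set (Set Ordinal.{0})) : Prop :=
  Y ⊆ POmega1 ∧ ∀ E, IsClubPOmega1 E → (Y ∩ E).Nonempty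

/-- `Y` is thin: for all `β < ω₂`, the set `{a ∩ β : a ∈ Y}` has size at most `ω₁`. -/
def IsThin (Y : Set (Set Ordinal.{0})) : Prop :=
  ∀ β < (ω_ 2 : Ordinal.{0}), #((fun a : Set Ordinal.{0} => a ∩ Set.Iio β) '' Y) ≤ ℵ_ 1

/-- `Y` is closed under initial segments. -/
def ClosedUnderInitialSegments (Y : Set (Set Ordinal.{0})) : Prop :=
  ∀ a ∈ Y, ∀ β < (ω_ 2 : Ordinal.{0}), a ∩ Set.Iio β ∈ Y

/-! ### The structure `(H(ω₂), ∈, π, Y)` and Skolem hulls -/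

/-- Relation symbols: membership, the graph of `π`, and the predicate `Y`. -/
inductive SideRel : ℕ → Type
  | mem : SideRel 2
  | pi : SideRel 2
  | inY : SideRel 1

/-- The first-order language of the structure `(H(ω₂), ∈, π, Y)`. -/
def sideLang : FirstOrder.Language.{0, 0} := ⟨fun _ => Empty, SideRel⟩

/-- The underlying type of the structure `(H(ω₂), ∈, π, Y)`: its elements are the elements
of `H(ω₂)`. -/
@[ext]
structure SideModel (π : Omega2 ≃ HOmega2) (Y : Set (Set Ordinal.{0})) : Type 1 where
  toSet : ZFSet.{0}
  mem : toSet ∈ HOmega2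

/-- The structure `(H(ω₂), ∈, π, Y)`. -/
instance sideStructure (π : Omega2 ≃ HOmega2) (Y : Set (Set Ordinal.{0})) :
    sideLang.Structure (SideModel π Y) where
  funMap f := nomatch f
  RelMap r := match r with
    | SideRel.mem => fun v => (v 0).toSet ∈ (v 1).toSet
    | SideRel.pi => fun v =>
        ∃ α : Omega2, (v 0).toSet = α.1.toZFSet ∧ (v 1).toSet = (π α).1
    | SideRel.inY => fun v => ∃ a ∈ Y, (v 0).toSet = setCode a

/-- A set of definable Skolem functions for the structure `(H(ω₂), ∈, π, Y)`: for every
formula `φ(x₀, …, xₙ₋₁, y)` a function `fn φ`, definable without parameters, such that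
`φ(x, fn φ x)` holds whenever some `y` satisfies `φ(x, y)`. -/
structure SkolemFunctions (π : Omega2 ≃ HOmega2) (Y : Set (Set Ordinal.{0})) where
  fn : ∀ {n : ℕ}, sideLang.Formula (Fin (n + 1)) → (Fin n → SideModel π Y) → SideModel π Y
  definable : ∀ {n : ℕ} (φ : sideLang.Formula (Fin (n + 1))),
    (∅ : Set (SideModel π Y)).DefinableFun sideLang (fn φ)
  spec : ∀ {n : ℕ} (φ : sideLang.Formula (Fin (n + 1))) (x : Fin n → SideModel π Y),
    (∃ y : SideModel π Y, φ.Realize (Fin.snoc x y : Fin (n + 1) → SideModel π Y)) →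
      φ.Realize (Fin.snoc x (fn φ x) : Fin (n + 1) → SideModel π Y)

section

variable {π : Omega2 ≃ HOmega2} {Y : Set (Set Ordinal.{0})}

/-- The closure of a subset of `H(ω₂)` under the Skolem functions. -/
inductive SkolemClosure (S : SkolemFunctions π Y) (B : Set (SideModel π Y)) :
    SideModel π Y → Prop
  | base (x : SideModel π Y) (hx : x ∈ B) : SkolemClosure S B x
  | app {n : ℕ} (φ : sideLang.Formula (Fin (n + 1))) (x : Fin n → SideModel π Y)
      (hx : ∀ i, SkolemClosure S B (x i)) : SkolemClosure S B (S.fn φ x)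

/-- `Sk(a)` for a set `a` of ordinals below `ω₂`. -/
def Sk (S : SkolemFunctions π Y) (a : Set Ordinal.{0}) : Set ZFSet.{0} :=
  {z | ∃ x : SideModel π Y,
    x.toSet = z ∧ SkolemClosure S {y | ∃ α ∈ a, y.toSet = α.toZFSet} x}

/-- `Sk(a) ∩ ω₂`. -/
def skOrd (S : SkolemFunctions π Y) (a : Set Ordinal.{0}) : Set Ordinal.{0} :=
  {α | α < ω_ 2 ∧ α.toZFSet ∈ Sk S a}

/-- The club `C` of all `β < ω₂` with `Sk(β) ∩ ω₂ = β`. -/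
def clubC (S : SkolemFunctions π Y) : Set Ordinal.{0} :=
  {β | β < ω_ 2 ∧ skOrd S (Set.Iio β) = Set.Iio β}

/-- The set `Λ` of all `β < ω₂` of cofinality `ω₁` which are limit points of `C`. -/
def bigLambda (S : SkolemFunctions π Y) : Set Ordinal.{0} :=
  {β | β < ω_ 2 ∧ β.cof = ℵ_ 1 ∧ ∀ γ < β, ∃ δ ∈ clubC S, γ < δ ∧ δ < β}

/-- The set `𝒳` of all `M ∈ Y` such that `Sk(M) ∩ ω₂ = M` and `sup(C ∩ γ) ∈ M` for all
`γ ∈ M`. -/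
def modelsX (S : SkolemFunctions π Y) : Set (Set Ordinal.{0}) :=
  {M | M ∈ Y ∧ skOrd S M = M ∧ ∀ γ ∈ M, sSup (clubC S ∩ Set.Iio γ) ∈ M}

/-- `Γ_M`: the set of all `β ∈ Γ` with `β = min(Γ \ sup(M ∩ β))`. -/
def gammaOf (Γ M : Set Ordinal.{0}) : Set Ordinal.{0} :=
  {β | IsLeast {γ | γ ∈ Γ ∧ sSup (M ∩ Set.Iio β) ≤ γ} β}

/-- The comparison point `β_{M,N}`: the largest element of `Γ_M ∩ Γ_N`. -/
noncomputable def cmpPoint (Γ M N : Set Ordinal.{0}) : Ordinal.{0} :=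
  sSup (gammaOf Γ M ∩ gammaOf Γ N)

/-- Adequate sets of models. -/
def Adequate (S : SkolemFunctions π Y) (Γ : Set Ordinal.{0}) (A : Set (Set Ordinal.{0})) :
    Prop :=
  A ⊆ modelsX S ∧ ∀ M ∈ A, ∀ N ∈ A,
    M ∩ Set.Iio (cmpPoint Γ M N) = N ∩ Set.Iio (cmpPoint Γ M N) ∨
    setCode (M ∩ Set.Iio (cmpPoint Γ M N)) ∈ Sk S N ∨
    setCode (N ∩ Set.Iio (cmpPoint Γ M N)) ∈ Sk S M

end

/-! ### Finite trees on `ω₁` -/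

/-- A finite tree on `ω₁`. -/
structure FinTree where
  carrier : Finset Ordinal.{0}
  lt : Ordinal.{0} → Ordinal.{0} → Prop
  carrier_lt : ∀ a ∈ carrier, a < ω_ 1
  lt_mem : ∀ a b, lt a b → a ∈ carrier ∧ b ∈ carrier
  irrefl : ∀ a, ¬ lt a a
  trans : ∀ a b c, lt a b → lt b c → lt a c
  comparable : ∀ a b c, lt a c → lt b c → a = b ∨ lt a b ∨ lt b a
  lt_of_lt : ∀ a b, lt a b → a < b

namespace FinTree

/-- `a ≤_T b`. -/
def le (T : FinTree) (a b : Ordinal.{0}) : Prop := a = b ∨ T.lt a b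

/-- Maximal nodes of a finite tree. -/
def IsMaximal (T : FinTree) (a : Ordinal.{0}) : Prop := a ∈ T.carrier ∧ ∀ b, ¬ T.lt a b

/-- `U` end-extends `T`. -/
def EndExtends (U T : FinTree) : Prop :=
  T.carrier ⊆ U.carrier ∧ ∀ a ∈ T.carrier, ∀ b ∈ T.carrier, (U.lt a b ↔ T.lt a b)

end FinTree

/-! ### The forcing poset -/

/-- Conditions `(T, F, A)` of the forcing poset adding an `ω₁`-Kurepa tree. -/
structure KurepaCond {π : Omega2 ≃ HOmega2} {Y : Set (Set Ordinal.{0})}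
    (S : SkolemFunctions π Y) (Γ : Set Ordinal.{0}) where
  T : FinTree
  F : {a : Ordinal.{0} // T.IsMaximal a} ↪ Omega2
  A : Set (Set Ordinal.{0})
  finite : A.Finite
  adequate : Adequate S Γ A
  mem_of_lt_lt : ∀ M ∈ A, ∀ a b : {a : Ordinal.{0} // T.IsMaximal a}, a ≠ b →
    (F a).1 ∈ M → (F b).1 ∈ M → ∀ c, T.lt c a.1 → T.lt c b.1 → c ∈ M

/-- The ordering of the forcing poset: `q ≤ p` if `T_q` end-extends `T_p`, `A_p ⊆ A_q`, and every
maximal node `a` of `T_p` has a maximal node `b` of `T_q` above or equal to it with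
`F_p(a) = F_q(b)`. -/
instance kurepaPreorder {π : Omega2 ≃ HOmega2} {Y : Set (Set Ordinal.{0})}
    (S : SkolemFunctions π Y) (Γ : Set Ordinal.{0}) : Preorder (KurepaCond S Γ) where
  le q p := q.T.EndExtends p.T ∧ p.A ⊆ q.A ∧
    ∀ a : {a : Ordinal.{0} // p.T.IsMaximal a}, ∃ b : {b : Ordinal.{0} // q.T.IsMaximal b},
      q.T.le a.1 b.1 ∧ p.F a = q.F b
  le_refl p := ⟨⟨Finset.Subset.refl _, fun _ _ _ _ => Iff.rfl⟩, Set.Subset.refl _,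
    fun a => ⟨a, Or.inl rfl, rfl⟩⟩
  le_trans r q p hrq hqp := by
    obtain ⟨⟨h1, h2⟩, h3, h4⟩ := hrq
    obtain ⟨⟨k1, k2⟩, k3, k4⟩ := hqp
    refine ⟨⟨k1.trans h1, fun a ha b hb => (h2 a (k1 ha) b (k1 hb)).trans (k2 a ha b hb)⟩,
      k3.trans h3, fun a => ?_⟩
    obtain ⟨b, hab, hFb⟩ := k4 a
    obtain ⟨c, hbc, hFc⟩ := h4 b
    refine ⟨c, ?_, hFb.trans hFc⟩
    rcases hab with hab | hab
    · rw [hab]; exact hbc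
    · have hab' : r.T.lt a.1 b.1 := (h2 _ (k1 a.2.1) _ b.2.1).2 hab
      rcases hbc with hbc | hbc
      · exact Or.inr (hbc ▸ hab')
      · exact Or.inr (r.T.trans _ _ _ hab' hbc)

/-- `p` and `q` are compatible: they have a common extension. -/
def Compatible {P : Type*} [Preorder P] (p q : P) : Prop := ∃ r, r ≤ p ∧ r ≤ q

/-- The `ω₂`-chain condition: every set of pairwise incompatible conditions has cardinality
less than `ℵ₂`. -/
def Omega2CC (P : Type*) [Preorder P] : Prop :=
  ∀ D : Set P, (∀ p ∈ D, ∀ q ∈ D, p ≠ q → ¬ Compatible p q) → #D < ℵ_ 2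

end AdequateKurepa

/-! Suppose `p β`, for `β < ω₂`, are distinct conditions from an antichain. For `β ∈ Γ`, which has
cofinality `ω₁`, the countably many ordinals occurring in `p β` below `β` are bounded by some `ζ <
β`. So the trace of `p β` below `β` (the whole tree, and `F` and `A` cut at `β`) lies in a set
depending only on `ζ`, of size at most `ℵ₁` by thinness. Pressing down on `Γ`
(`exists_unbounded_fiber`) gives `β < β'` in `Γ` with equal traces, where `β'` also lies above
everything occurring in `p β`. Such a pair is compatible (`KurepaCond.compatible_of_trace_eq`), a
contradiction.

For compatibility, the two trees coincide, and one new node is placed above the appropriate maximal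
node for each value of either function (`KurepaCond.compatible_of_graph`). The main point is
adequacy of the union of the side conditions (`Adequate.union`). Each `N` from the upper condition
has a reflection `M'` in the lower one, with `N ∩ β' = M' ∩ β`. The comparison point of `N` with a
lower `M` is at most `β`, where `N` and `M'` agree, so the relation of `M` to `M'` transfers to `N`.
Moving a membership from `Sk(M')` to `Sk(N)` requires the `π`-index of a bounded member of `Y` to
lie below `β`; this follows from thinness, elementarity and `β` being a limit of `C`
(`pi_symm_lt_of_mem_clubC`). -/

namespace AdequateKurepa

/-! ### Definable predicates and Skolem hulls -/

section Definability

variable {π : Omega2 ≃ HOmega2} {Y : Set (Set Ordinal.{0})}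

/-- A predicate on `n`-tuples which is definable without parameters. -/
def DefPred {n : ℕ} (P : (Fin n → SideModel π Y) → Prop) : Prop :=
  ∃ φ : sideLang.Formula (Fin n), ∀ x, φ.Realize x ↔ P x

/-- A coordinate projection on `n`-tuples. -/
def IsCoord {n : ℕ} (f : (Fin n → SideModel π Y) → SideModel π Y) : Prop :=
  ∃ i, ∀ x, f x = x i

variable {n : ℕ}

theorem IsCoord.apply (i : Fin n) : IsCoord (fun x : Fin n → SideModel π Y => x i) :=
  ⟨i, fun _ => rfl⟩

theorem IsCoord.init {f : (Fin n → SideModel π Y) → SideModel π Y} (hf : IsCoord f) :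
    IsCoord (fun x : Fin (n + 1) → SideModel π Y => f (fun i => x i.castSucc)) := by
  obtain ⟨i, hi⟩ := hf
  exact ⟨i.castSucc, fun x => hi _⟩

namespace DefPred

variable {P Q : (Fin n → SideModel π Y) → Prop} {f g : (Fin n → SideModel π Y) → SideModel π Y}

theorem rel₁ (r : sideLang.Relations 1) (hf : IsCoord f) :
    DefPred (fun x => FirstOrder.Language.Structure.RelMap r ![f x]) := by
  obtain ⟨i, hi⟩ := hf
  refine ⟨r.formula₁ (.var i), fun x => ?_⟩
  rw [FirstOrder.Language.Formula.realize_rel₁]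
  simp [hi]

theorem rel₂ (r : sideLang.Relations 2) (hf : IsCoord f) (hg : IsCoord g) :
    DefPred (fun x => FirstOrder.Language.Structure.RelMap r ![f x, g x]) := by
  obtain ⟨i, hi⟩ := hf
  obtain ⟨j, hj⟩ := hg
  refine ⟨r.formula₂ (.var i) (.var j), fun x => ?_⟩
  rw [FirstOrder.Language.Formula.realize_rel₂]
  simp [hi, hj]

theorem mem (hf : IsCoord f) (hg : IsCoord g) : DefPred (fun x => (f x).toSet ∈ (g x).toSet) :=
  rel₂ SideRel.mem hf hg

theorem graph (hf : IsCoord f) (hg : IsCoord g) : DefPred (fun x =>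
    ∃ α : Omega2, (f x).toSet = α.1.toZFSet ∧ (g x).toSet = (π α).1) :=
  rel₂ SideRel.pi hf hg

theorem inY (hf : IsCoord f) : DefPred (fun x => ∃ a ∈ Y, (f x).toSet = setCode a) :=
  rel₁ SideRel.inY hf

theorem eq (hf : IsCoord f) (hg : IsCoord g) : DefPred (fun x => f x = g x) := by
  obtain ⟨i, hi⟩ := hf
  obtain ⟨j, hj⟩ := hg
  refine ⟨FirstOrder.Language.Term.equal (.var i) (.var j), fun x => ?_⟩
  rw [FirstOrder.Language.Formula.realize_equal]
  simp [hi, hj]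

theorem imp (hP : DefPred P) (hQ : DefPred Q) : DefPred (fun x => P x → Q x) := by
  obtain ⟨φ, hφ⟩ := hP
  obtain ⟨ψ, hψ⟩ := hQ
  exact ⟨φ.imp ψ, fun x => by rw [FirstOrder.Language.Formula.realize_imp, hφ, hψ]⟩

theorem not (hP : DefPred P) : DefPred (fun x => ¬ P x) := by
  obtain ⟨φ, hφ⟩ := hP
  exact ⟨φ.not, fun x => by rw [FirstOrder.Language.Formula.realize_not, hφ]⟩

theorem and (hP : DefPred P) (hQ : DefPred Q) : DefPred (fun x => P x ∧ Q x) := by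
  obtain ⟨φ, hφ⟩ := hP
  obtain ⟨ψ, hψ⟩ := hQ
  exact ⟨φ ⊓ ψ, fun x => by rw [FirstOrder.Language.Formula.realize_inf, hφ, hψ]⟩

theorem or (hP : DefPred P) (hQ : DefPred Q) : DefPred (fun x => P x ∨ Q x) := by
  obtain ⟨φ, hφ⟩ := hP
  obtain ⟨ψ, hψ⟩ := hQ
  exact ⟨φ ⊔ ψ, fun x => by rw [FirstOrder.Language.Formula.realize_sup, hφ, hψ]⟩

theorem iff (hP : DefPred P) (hQ : DefPred Q) : DefPred (fun x => P x ↔ Q x) := by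
  obtain ⟨φ, hφ⟩ := hP
  obtain ⟨ψ, hψ⟩ := hQ
  exact ⟨φ.iff ψ, fun x => by rw [FirstOrder.Language.Formula.realize_iff, hφ, hψ]⟩

theorem all {R : (Fin n → SideModel π Y) → SideModel π Y → Prop}
    (h : DefPred (fun x : Fin (n + 1) → SideModel π Y =>
      R (fun i => x i.castSucc) (x (Fin.last n)))) :
    DefPred (fun x => ∀ y, R x y) := by
  obtain ⟨φ, hφ⟩ := h
  -- The last free variable becomes the single bound variable; the others stay free.
  refine ⟨(FirstOrder.Language.BoundedFormula.relabel (k := 0) (n := 1)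
    (fun i : Fin (n + 1) => Fin.lastCases (motive := fun _ => Fin n ⊕ Fin 1) (Sum.inr 0)
      (fun j => Sum.inl j) i) φ).all, fun x => ?_⟩
  rw [FirstOrder.Language.Formula.Realize, FirstOrder.Language.BoundedFormula.realize_all]
  refine forall_congr' fun y => ?_
  rw [FirstOrder.Language.BoundedFormula.realize_relabel]
  have := hφ (Fin.snoc (α := fun _ => SideModel π Y) x y)
  simp only [Fin.snoc_castSucc, Fin.snoc_last] at this
  rw [← this, FirstOrder.Language.Formula.Realize]
  apply Iff.of_eq
  congr 1
  · ext i
    refine Fin.lastCases ?_ (fun j => ?_) i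
    · simp [Fin.snoc]
    · simp
  · exact Subsingleton.elim _ _

theorem ex {R : (Fin n → SideModel π Y) → SideModel π Y → Prop}
    (h : DefPred (fun x : Fin (n + 1) → SideModel π Y =>
      R (fun i => x i.castSucc) (x (Fin.last n)))) :
    DefPred (fun x => ∃ y, R x y) := by
  simpa only [not_forall, not_not] using (all (R := fun x y => ¬ R x y) h.not).not

end DefPred

/-- The closure `Sk(a)` as a subset of the structure. -/
def skSet (S : SkolemFunctions π Y) (a : Set Ordinal.{0}) : Set (SideModel π Y) :=
  {x | SkolemClosure S {y | ∃ α ∈ a, y.toSet = α.toZFSet} x}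

/-- The Tarski–Vaught property, and the only way elementarity is used: each later hull argument
writes down a definable `R` and takes its witness from the hull. -/
theorem DefPred.exists_mem_skSet {S : SkolemFunctions π Y} {a : Set Ordinal.{0}}
    {R : (Fin n → SideModel π Y) → SideModel π Y → Prop}
    (h : DefPred (fun x : Fin (n + 1) → SideModel π Y =>
      R (fun i => x i.castSucc) (x (Fin.last n)))) {x : Fin n → SideModel π Y}
    (hx : ∀ i, x i ∈ skSet S a) (hR : ∃ y, R x y) : ∃ y ∈ skSet S a, R x y := by
  obtain ⟨φ, hφ⟩ := h
  have key : ∀ y, φ.Realize (Fin.snoc x y : Fin (n + 1) → SideModel π Y) ↔ R x y := fun y => by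
    simpa only [Fin.snoc_castSucc, Fin.snoc_last] using
      hφ (Fin.snoc (α := fun _ => SideModel π Y) x y)
  refine ⟨S.fn φ x, SkolemClosure.app φ x hx, (key _).1 (S.spec φ x ?_)⟩
  simpa only [key] using hR

/-! ### Closure properties of `H(ω₂)` -/

theorem mem_HOmega2_of_mem {x y : ZFSet.{0}} (hx : x ∈ HOmega2) (h : y ∈ x) : y ∈ HOmega2 := by
  obtain ⟨t, ht, hxt, hc⟩ := hx
  exact ⟨t, ht, ht _ (hxt h), hc⟩

theorem mem_HOmega2_of_subset {x y : ZFSet.{0}} (hx : x ∈ HOmega2) (h : y ⊆ x) : y ∈ HOmega2 := by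
  obtain ⟨t, ht, hxt, hc⟩ := hx
  exact ⟨t, ht, fun z hz => hxt (h hz), hc⟩

theorem toZFSet_mem_HOmega2 {α : Ordinal.{0}} (h : α < ω_ 2) : α.toZFSet ∈ HOmega2 :=
  ⟨α.toZFSet, (ZFSet.isOrdinal_toZFSet α).isTransitive, fun _ h => h, by
    rw [Ordinal.card_toZFSet]; exact Cardinal.lt_ord.1 (by simpa using h)⟩

theorem isRegular_aleph_two : (ℵ_ 2 : Cardinal.{0}).IsRegular := by
  have := Cardinal.isRegular_aleph_add_one 1
  rwa [one_add_one_eq_two] at this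

/-- Regularity of `ℵ₂` bounds the union of countably many small transitive sets. -/
theorem range_mem_HOmega2 {f : ℕ → ZFSet.{0}} (h : ∀ n, f n ∈ HOmega2) :
    ZFSet.range f ∈ HOmega2 := by
  choose t ht hft hc using h
  refine ⟨ZFSet.range f ∪ ZFSet.iUnion t, ?_, ?_, ?_⟩
  · intro y hy z hz
    simp only [ZFSet.mem_union, ZFSet.mem_range, ZFSet.mem_iUnion] at hy ⊢
    right
    rcases hy with ⟨n, rfl⟩ | ⟨n, hn⟩
    · exact ⟨n, hft n hz⟩
    · exact ⟨n, ht n _ hn hz⟩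
  · intro y hy
    exact ZFSet.mem_union.2 (Or.inl hy)
  · refine ZFSet.card_union_le.trans_lt (Cardinal.add_lt_of_lt isRegular_aleph_two.aleph0_le ?_ ?_)
    · have := ZFSet.lift_card_range_le (f := f)
      simp only [Cardinal.lift_id, Cardinal.mk_nat] at this
      exact this.trans_lt (by simp)
    · have := ZFSet.lift_card_iUnion_le_sum_card (f := t)
      simp only [Cardinal.lift_id] at this
      refine this.trans_lt (Cardinal.sum_lt_lift_of_isRegular isRegular_aleph_two (by simp) hc)

theorem pair_set_mem_HOmega2 {x y : ZFSet.{0}} (hx : x ∈ HOmega2) (hy : y ∈ HOmega2) :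
    ({x, y} : ZFSet.{0}) ∈ HOmega2 := by
  have : ({x, y} : ZFSet.{0}) = ZFSet.range (fun n : ℕ => if n = 0 then x else y) := by
    ext z
    simp only [ZFSet.mem_pair, ZFSet.mem_range]
    constructor
    · rintro (rfl | rfl)
      exacts [⟨0, by simp⟩, ⟨1, by simp⟩]
    · rintro ⟨n, rfl⟩
      split_ifs <;> simp
  rw [this]
  exact range_mem_HOmega2 fun n => by split_ifs <;> assumption

theorem pair_mem_HOmega2 {x y : ZFSet.{0}} (hx : x ∈ HOmega2) (hy : y ∈ HOmega2) :
    ZFSet.pair x y ∈ HOmega2 := by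
  have h := pair_set_mem_HOmega2 hx hx
  rw [ZFSet.pair_eq_singleton] at h
  exact pair_set_mem_HOmega2 h (pair_set_mem_HOmega2 hx hy)

theorem toZFSet_mem_setCode {a : Set Ordinal.{0}} {α : Ordinal.{0}} (ha : a ⊆ Set.Iio (ω_ 2)) :
    α.toZFSet ∈ setCode a ↔ α ∈ a := by
  simp only [setCode, ZFSet.mem_sep, Ordinal.toZFSet_mem_toZFSet_iff,
    Ordinal.toZFSet_injective.eq_iff]
  exact ⟨by rintro ⟨_, b, hb, rfl⟩; exact hb, fun h => ⟨ha h, α, h, rfl⟩⟩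

theorem mem_setCode {a : Set Ordinal.{0}} {x : ZFSet.{0}} (ha : a ⊆ Set.Iio (ω_ 2)) :
    x ∈ setCode a ↔ ∃ α ∈ a, α.toZFSet = x := by
  simp only [setCode, ZFSet.mem_sep, and_iff_right_iff_imp]
  rintro ⟨α, h, rfl⟩
  exact Ordinal.toZFSet_mem_toZFSet_iff.2 (ha h)

theorem setCode_mem_HOmega2 {a : Set Ordinal.{0}} (ha : a ∈ POmega1) : setCode a ∈ HOmega2 := by
  rcases a.eq_empty_or_nonempty with rfl | hne
  · refine ⟨∅, ZFSet.isTransitive_empty, fun x hx => ?_, by simp [Cardinal.aleph_pos]⟩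
    simp [setCode] at hx
  · obtain ⟨f, rfl⟩ := ha.2.exists_eq_range hne
    have : setCode (Set.range f) = ZFSet.range (fun n => (f n).toZFSet) := by
      ext x
      rw [mem_setCode ha.1]
      simp
    rw [this]
    exact range_mem_HOmega2 fun n => toZFSet_mem_HOmega2 (ha.1 ⟨n, rfl⟩)

theorem SideModel.ext_mem {x y : SideModel π Y}
    (h : ∀ z : SideModel π Y, z.toSet ∈ x.toSet ↔ z.toSet ∈ y.toSet) : x = y := by
  ext z
  exact ⟨fun hz => (h ⟨z, mem_HOmega2_of_mem x.mem hz⟩).1 hz,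
    fun hz => (h ⟨z, mem_HOmega2_of_mem y.mem hz⟩).2 hz⟩

namespace DefPred

variable {f g h : (Fin n → SideModel π Y) → SideModel π Y}

/-- Since `H(ω₂)` is transitive, quantifying over the structure sees all elements of a set, so
extensionality turns the equation into a first-order formula. -/
theorem eq_pair_set (hf : IsCoord f) (hg : IsCoord g) (hh : IsCoord h) :
    DefPred (fun x => (f x).toSet = {(g x).toSet, (h x).toSet}) := by
  have : (fun x => (f x).toSet = {(g x).toSet, (h x).toSet}) =
      fun x => ∀ y : SideModel π Y, y.toSet ∈ (f x).toSet ↔ y = g x ∨ y = h x := by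
    ext x
    constructor
    · intro e y
      rw [e, ZFSet.mem_pair, SideModel.ext_iff, SideModel.ext_iff]
    · intro e
      exact congrArg SideModel.toSet (SideModel.ext_mem (x := f x)
        (y := ⟨_, pair_set_mem_HOmega2 (g x).mem (h x).mem⟩) fun z => by
          rw [e, ZFSet.mem_pair, SideModel.ext_iff, SideModel.ext_iff])
  rw [this]
  exact all (iff (mem (.apply _) hf.init) (or (eq (.apply _) hg.init) (eq (.apply _) hh.init)))

theorem eq_pair (hf : IsCoord f) (hg : IsCoord g) (hh : IsCoord h) :
    DefPred (fun x => (f x).toSet = ZFSet.pair (g x).toSet (h x).toSet) := by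
  have : (fun x => (f x).toSet = ZFSet.pair (g x).toSet (h x).toSet) =
      fun x => ∃ y z : SideModel π Y, y.toSet = {(g x).toSet, (g x).toSet} ∧
        z.toSet = {(g x).toSet, (h x).toSet} ∧ (f x).toSet = {y.toSet, z.toSet} := by
    ext x
    constructor
    · intro e
      exact ⟨⟨_, pair_set_mem_HOmega2 (g x).mem (g x).mem⟩,
        ⟨_, pair_set_mem_HOmega2 (g x).mem (h x).mem⟩, rfl, rfl, by
          simp [e, ZFSet.pair]⟩
    · rintro ⟨y, z, hy, hz, e⟩
      rw [e, hy, hz, ZFSet.pair, ZFSet.pair_eq_singleton]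
  rw [this]
  exact ex (ex (and (eq_pair_set (IsCoord.apply _).init hg.init.init hg.init.init)
    (and (eq_pair_set (.apply _) hg.init.init hh.init.init)
      (eq_pair_set hf.init.init (IsCoord.apply _).init (.apply _)))))

end DefPred

/-! ### Elementarity of Skolem hulls -/

section Hulls

variable {S : SkolemFunctions π Y} {a : Set Ordinal.{0}}

theorem mem_Sk {z : ZFSet.{0}} : z ∈ Sk S a ↔ ∃ x ∈ skSet S a, x.toSet = z :=
  ⟨fun ⟨x, h, k⟩ => ⟨x, k, h⟩, fun ⟨x, h, k⟩ => ⟨x, k, h⟩⟩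

theorem toSet_mem_Sk {x : SideModel π Y} : x.toSet ∈ Sk S a ↔ x ∈ skSet S a := by
  rw [mem_Sk]
  exact ⟨by rintro ⟨y, h, e⟩; rwa [← SideModel.ext e], fun h => ⟨x, h, rfl⟩⟩

theorem toZFSet_mem_Sk {α : Ordinal.{0}} (hα : α < ω_ 2) (h : α ∈ a) : α.toZFSet ∈ Sk S a :=
  ⟨⟨_, toZFSet_mem_HOmega2 hα⟩, rfl, SkolemClosure.base _ ⟨α, h, rfl⟩⟩

theorem pi_mem_Sk {α : Omega2} (h : α.1 ∈ a) : (π α).1 ∈ Sk S a := by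
  obtain ⟨x, hx, e⟩ := mem_Sk.1 (toZFSet_mem_Sk (S := S) α.2 h)
  obtain ⟨y, hy, β, h1, h2⟩ := DefPred.exists_mem_skSet (S := S) (a := a) (n := 1)
    (R := fun v y => ∃ α : Omega2, (v 0).toSet = α.1.toZFSet ∧ y.toSet = (π α).1)
    (.graph (.apply _) (.apply _)) (x := fun _ => x) (fun _ => hx)
    ⟨⟨_, (π α).2⟩, α, e, rfl⟩
  obtain rfl : α = β := Subtype.ext (Ordinal.toZFSet_injective (e.symm.trans h1))
  exact mem_Sk.2 ⟨y, hy, h2⟩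

theorem pi_symm_mem_skOrd {z : HOmega2} (h : z.1 ∈ Sk S a) : (π.symm z).1 ∈ skOrd S a := by
  obtain ⟨x, hx, e⟩ := mem_Sk.1 h
  obtain ⟨y, hy, β, h1, h2⟩ := DefPred.exists_mem_skSet (S := S) (a := a) (n := 1)
    (R := fun v y => ∃ α : Omega2, y.toSet = α.1.toZFSet ∧ (v 0).toSet = (π α).1)
    (.graph (.apply _) (.apply _)) (x := fun _ => x) (fun _ => hx)
    ⟨⟨_, toZFSet_mem_HOmega2 (π.symm z).2⟩, π.symm z, rfl, by simpa using e⟩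
  have : π.symm z = β := by
    rw [Equiv.symm_apply_eq]
    exact Subtype.ext (e.symm.trans h2)
  rw [this]
  exact ⟨β.2, mem_Sk.2 ⟨y, hy, h1⟩⟩

theorem inter_mem_Sk {x y : ZFSet.{0}} (hx : x ∈ Sk S a) (hy : y ∈ Sk S a) : x ∩ y ∈ Sk S a := by
  obtain ⟨x, hx, rfl⟩ := mem_Sk.1 hx
  obtain ⟨y, hy, rfl⟩ := mem_Sk.1 hy
  obtain ⟨z, hz, h⟩ := DefPred.exists_mem_skSet (S := S) (a := a) (n := 2)
    (R := fun v z => ∀ w : SideModel π Y,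
      w.toSet ∈ z.toSet ↔ w.toSet ∈ (v 0).toSet ∧ w.toSet ∈ (v 1).toSet)
    (.all (.iff (.mem (.apply _) (.init (.apply _)))
      (.and (.mem (.apply _) (.init (.apply _))) (.mem (.apply _) (.init (.apply _))))))
    (x := ![x, y]) (by intro i; fin_cases i <;> assumption)
    ⟨⟨x.toSet ∩ y.toSet, mem_HOmega2_of_subset x.mem fun z hz => (ZFSet.mem_inter.1 hz).1⟩,
      fun w => by simp⟩
  refine mem_Sk.2 ⟨z, hz, congrArg SideModel.toSet (SideModel.ext_mem (x := z)
    (y := ⟨x.toSet ∩ y.toSet, mem_HOmega2_of_subset x.mem fun z hz => (ZFSet.mem_inter.1 hz).1⟩) fun w => ?_)⟩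
  rw [h]
  simp

/-- A countable element of a Skolem hull is a subset of it. -/
theorem subset_Sk_of_mem_Sk {f : ℕ → ZFSet.{0}} (hf : f.Injective) (hfH : ∀ n, f n ∈ HOmega2)
    {x : ZFSet.{0}} (hxa : x ∈ Sk S a) (hxf : x ⊆ ZFSet.range f) {w : ZFSet.{0}} (hw : w ∈ x) :
    w ∈ Sk S a := by
  obtain ⟨x, hx, rfl⟩ := mem_Sk.1 hxa
  -- `R x s z`: the relation `s` is single-valued, and every set containing `z` and closed under `s`
  -- includes `x`. This expresses countability of `x` through a successor map, without mentioning
  -- `ω`.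
  let R : SideModel π Y → SideModel π Y → SideModel π Y → Prop := fun x s z =>
    (∀ u v v' p p' : SideModel π Y, p.toSet = ZFSet.pair u.toSet v.toSet →
      p'.toSet = ZFSet.pair u.toSet v'.toSet → p.toSet ∈ s.toSet → p'.toSet ∈ s.toSet → v = v') ∧
    ∀ t : SideModel π Y, z.toSet ∈ t.toSet →
      (∀ u v p : SideModel π Y, p.toSet = ZFSet.pair u.toSet v.toSet → p.toSet ∈ s.toSet →
        u.toSet ∈ t.toSet → v.toSet ∈ t.toSet) →
      ∀ w : SideModel π Y, w.toSet ∈ x.toSet → w.toSet ∈ t.toSet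
  have hR : ∀ {n} {f g h : (Fin n → SideModel π Y) → SideModel π Y},
      IsCoord f → IsCoord g → IsCoord h → DefPred (fun v => R (f v) (g v) (h v)) := by
    rintro n f g h ⟨i, hi⟩ ⟨j, hj⟩ ⟨k, hk⟩
    obtain rfl : f = fun v => v i := funext hi
    obtain rfl : g = fun v => v j := funext hj
    obtain rfl : h = fun v => v k := funext hk
    repeat' first
      | apply DefPred.and
      | apply DefPred.imp
      | apply DefPred.all
      | apply DefPred.eq_pair
      | apply DefPred.mem
      | apply DefPred.eq
      | exact IsCoord.apply _
  have hpH : ∀ n, ZFSet.pair (f n) (f (n + 1)) ∈ HOmega2 := fun n =>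
    pair_mem_HOmega2 (hfH _) (hfH _)
  obtain ⟨s, hs, hsz⟩ := DefPred.exists_mem_skSet (S := S) (a := a) (n := 1)
    (R := fun v s => ∃ z, R (v 0) s z)
    (.ex (hR (.init (.apply _)) (.init (.apply _)) (.apply _))) (x := fun _ => x) (fun _ => hx) (by
      refine ⟨⟨_, range_mem_HOmega2 hpH⟩, ⟨_, hfH 0⟩, ?_, ?_⟩
      · intro u v v' p p' h1 h2 h3 h4
        simp only [h1, h2, ZFSet.mem_range, ZFSet.pair_inj] at h3 h4
        obtain ⟨i, hi, hi'⟩ := h3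
        obtain ⟨j, hj, hj'⟩ := h4
        obtain rfl := hf (hi.trans hj.symm)
        exact SideModel.ext (hi'.symm.trans hj')
      · intro t h0 hstep w hw
        obtain ⟨n, hn⟩ := ZFSet.mem_range.1 (hxf hw)
        rw [← hn]
        clear hn
        induction n with
        | zero => exact h0
        | succ n ih =>
          exact hstep ⟨_, hfH n⟩ ⟨_, hfH (n + 1)⟩ ⟨_, hpH n⟩ rfl (ZFSet.mem_range.2 ⟨n, rfl⟩) ih)
  obtain ⟨z, hz, hfun, hind⟩ := DefPred.exists_mem_skSet (S := S) (a := a) (n := 2)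
    (R := fun v z => R (v 0) (v 1) z) (hR (.apply _) (.apply _) (.apply _))
    (x := ![x, s]) (by intro i; fin_cases i <;> assumption) hsz
  obtain ⟨T, hT, hsT, hTc⟩ := pair_set_mem_HOmega2 s.mem z.mem
  have hTH : T ∈ HOmega2 := ⟨T, hT, fun _ h => h, hTc⟩
  have hz' : z.toSet ∈ T := hsT (by simp)
  have hs' : s.toSet ∈ T := hsT (by simp)
  -- The part of the hull inside a transitive set containing `s` and `z` is itself in `H(ω₂)`, so it
  -- may serve as test set for `R`. It is closed under `s` because the `s`-successor of a point is
  -- unique, hence in the hull.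
  let t : SideModel π Y := ⟨ZFSet.sep (· ∈ Sk S a) T,
    mem_HOmega2_of_subset hTH fun _ h => (ZFSet.mem_sep.1 h).1⟩
  have ht : ∀ u, u ∈ t.toSet ↔ u ∈ T ∧ u ∈ Sk S a := fun u => ZFSet.mem_sep
  refine ((ht w).1 (hind t ?_ ?_ ⟨w, mem_HOmega2_of_mem x.mem hw⟩ hw)).2
  · exact (ht _).2 ⟨hz', toSet_mem_Sk.2 hz⟩
  · intro u v p hp hps hu
    have hu' := toSet_mem_Sk.1 ((ht _).1 hu).2
    refine (ht _).2 ⟨?_, toSet_mem_Sk.2 ?_⟩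
    · have h1 : ({u.toSet, v.toSet} : ZFSet) ∈ p.toSet := by simp [hp, ZFSet.pair]
      exact hT _ (hT _ (hT _ hs' hps) h1) (by simp)
    · obtain ⟨v', hv', p', hp', hps'⟩ := DefPred.exists_mem_skSet (S := S) (a := a) (n := 2)
        (R := fun x v => ∃ p : SideModel π Y, p.toSet = ZFSet.pair (x 0).toSet v.toSet ∧
          p.toSet ∈ (x 1).toSet)
        (.ex (.and (.eq_pair (.apply _) (.init (.apply _)) (.init (.apply _)))
          (.mem (.apply _) (.init (.apply _)))))
        (x := ![u, s]) (by intro i; fin_cases i <;> assumption) ⟨v, p, hp, hps⟩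
      rwa [hfun u v v' p p' hp hp' hps hps']

/-- A countable set of ordinals in a Skolem hull is a subset of the hull. -/
theorem subset_skOrd_of_setCode_mem_Sk {b : Set Ordinal.{0}} (hb : b ∈ POmega1)
    (h : setCode b ∈ Sk S a) : b ⊆ skOrd S a := by
  have hω : Set.Iio (ω : Ordinal.{0}) ⊆ Set.Iio (ω_ 2) :=
    Set.Iio_subset_Iio (Ordinal.omega0_le_omega 2)
  have hcω : (Set.Iio (ω : Ordinal.{0})).Countable := by
    rw [← Cardinal.le_aleph0_iff_set_countable, Cardinal.mk_Iio_ordinal]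
    simp
  -- Adjoining `ω` yields an injective enumeration by `ℕ` even when `b` is finite.
  have hinf : (b ∪ Set.Iio (ω : Ordinal.{0})).Infinite := by
    refine Set.Infinite.mono Set.subset_union_right ?_
    refine Set.infinite_of_injective_forall_mem (f := fun n : ℕ => (n : Ordinal.{0}))
      Nat.cast_injective fun n => Ordinal.natCast_lt_omega0 n
  have hsub : b ∪ Set.Iio (ω : Ordinal.{0}) ⊆ Set.Iio (ω_ 2) := Set.union_subset hb.1 hω
  have : Countable ↥(b ∪ Set.Iio (ω : Ordinal.{0})) := (hb.2.union hcω).to_subtype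
  have : Infinite ↥(b ∪ Set.Iio (ω : Ordinal.{0})) := hinf.to_subtype
  obtain ⟨e⟩ := nonempty_equiv_of_countable (α := ℕ) (β := ↥(b ∪ Set.Iio (ω : Ordinal.{0})))
  intro α hα
  refine ⟨hb.1 hα, subset_Sk_of_mem_Sk (f := fun n => (e n).1.toZFSet) ?_ ?_ h ?_
    ((toZFSet_mem_setCode hb.1).2 hα)⟩
  · exact fun m n h => e.injective (Subtype.ext (Ordinal.toZFSet_injective h))
  · exact fun n => toZFSet_mem_HOmega2 (hsub (e n).2)
  · intro x hx
    obtain ⟨β, hβ, rfl⟩ := (mem_setCode hb.1).1 hx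
    exact ZFSet.mem_range.2 ⟨e.symm ⟨β, Or.inl hβ⟩, by simp⟩

theorem setCode_inter_Iio {b : Set Ordinal.{0}} (hb : b ⊆ Set.Iio (ω_ 2)) (ξ : Ordinal.{0}) :
    setCode (b ∩ Set.Iio ξ) = setCode b ∩ ξ.toZFSet := by
  ext x
  rw [ZFSet.mem_inter, mem_setCode (Set.inter_subset_left.trans hb), mem_setCode hb]
  constructor
  · rintro ⟨α, ⟨h1, h2⟩, rfl⟩
    exact ⟨⟨α, h1, rfl⟩, Ordinal.toZFSet_mem_toZFSet_iff.2 h2⟩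
  · rintro ⟨⟨α, h1, rfl⟩, h2⟩
    exact ⟨α, ⟨h1, Ordinal.toZFSet_mem_toZFSet_iff.1 h2⟩, rfl⟩

/-- Initial segments of a countable set of ordinals in a Skolem hull are in the hull. -/
theorem setCode_inter_Iio_mem_Sk {b : Set Ordinal.{0}} (hb : b ∈ POmega1)
    (h : setCode b ∈ Sk S a) (δ : Ordinal.{0}) : setCode (b ∩ Set.Iio δ) ∈ Sk S a := by
  by_cases hne : (b \ Set.Iio δ).Nonempty
  · have hm := csInf_mem hne
    -- `δ` need not be in the hull, but `ξ` is an element of `b`, hence in the hull, and cuts `b` at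
    -- the same place.
    set ξ := sInf (b \ Set.Iio δ) with hξ
    have : b ∩ Set.Iio δ = b ∩ Set.Iio ξ := by
      ext α
      refine and_congr_right fun hα =>
        ⟨fun h => Set.mem_Iio.2 (lt_of_lt_of_le h (not_lt.1 hm.2)), fun h => ?_⟩
      by_contra hcon
      exact (csInf_le' (show α ∈ b \ Set.Iio δ from ⟨hα, hcon⟩)).not_gt h
    rw [this, setCode_inter_Iio hb.1]
    exact inter_mem_Sk h (subset_skOrd_of_setCode_mem_Sk hb h hm.1).2
  · rw [Set.not_nonempty_iff_eq_empty, Set.sdiff_eq_empty] at hne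
    rwa [Set.inter_eq_left.2 hne]

end Hulls
end Definability
/-! ### Bounded sets of ordinals -/

theorem exists_lt_subset_Iio {s : Set Ordinal.{0}} {o : Ordinal.{0}} (hs : s ⊆ Set.Iio o)
    (hc : #s < Cardinal.lift.{1} o.cof) : ∃ η < o, s ⊆ Set.Iio η := by
  rw [Ordinal.lift_cof] at hc
  refine ⟨_, Ordinal.sSup_add_one_lt_of_lt_cof hc hs, fun α hα => ?_⟩
  have hbdd : BddAbove ((fun x : Ordinal.{0} => x + 1) '' s) :=
    ⟨o, by rintro _ ⟨x, hx, rfl⟩; exact Order.add_one_le_of_lt (hs hx)⟩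
  exact (lt_add_one α).trans_le (le_csSup hbdd ⟨α, hα, rfl⟩)

theorem cof_omega_two : (ω_ 2 : Ordinal.{0}).cof = ℵ_ 2 := by
  rw [← Cardinal.ord_aleph]
  exact isRegular_aleph_two.cof_ord

theorem exists_lt_omega_two_subset_Iio {s : Set Ordinal.{0}} (hs : s ⊆ Set.Iio (ω_ 2))
    (hc : #s ≤ ℵ_ 1) : ∃ η < (ω_ 2 : Ordinal.{0}), s ⊆ Set.Iio η := by
  refine exists_lt_subset_Iio hs (hc.trans_lt ?_)
  rw [cof_omega_two, Cardinal.lift_aleph, Cardinal.aleph_lt_aleph]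
  simp

theorem exists_lt_inter_subset_Iio {s : Set Ordinal.{0}} (hs : s.Countable) {β : Ordinal.{0}}
    (hβ : ℵ₀ < β.cof) : ∃ ζ < β, s ∩ Set.Iio β ⊆ Set.Iio ζ := by
  refine exists_lt_subset_Iio Set.inter_subset_right ?_
  refine (Cardinal.le_aleph0_iff_set_countable.2 (hs.mono Set.inter_subset_left)).trans_lt ?_
  rwa [← Cardinal.lift_aleph0.{1, 0}, Cardinal.lift_lt]

/-! ### Adequate sets of models -/

section Adequate

variable {π : Omega2 ≃ HOmega2} {Y : Set (Set Ordinal.{0})} {S : SkolemFunctions π Y}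
  {Γ : Set Ordinal.{0}}

/-- A member of `Y` included in `ζ` is its own trace at `ζ`, so thinness bounds the number of such
sets, and `π` is injective. -/
theorem mk_codes_le (hY : Y ⊆ POmega1) (hYthin : IsThin Y) {ζ : Ordinal.{0}} (hζ : ζ < ω_ 2) :
    #{α : Ordinal.{0} | ∃ h : α < ω_ 2, ∃ a ∈ Y, a ⊆ Set.Iio ζ ∧
      (π ⟨α, h⟩).1 = setCode a} ≤ ℵ_ 1 := by
  classical
  refine le_trans ?_ (hYthin ζ hζ)
  let f : Set Ordinal.{0} → Ordinal.{0} := fun a => if h : setCode a ∈ HOmega2 then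
    (π.symm ⟨_, h⟩).1 else 0
  refine (Cardinal.mk_le_mk_of_subset ?_).trans (Cardinal.mk_image_le (f := f))
  rintro α ⟨h, a, ha, haζ, e⟩
  refine ⟨a, ⟨a, ha, Set.inter_eq_left.2 haζ⟩, ?_⟩
  have hH := setCode_mem_HOmega2 (hY ha)
  have : π ⟨α, h⟩ = ⟨_, hH⟩ := Subtype.ext e
  simp only [f, dif_pos hH, ← this, Equiv.symm_apply_apply]

/-- Bounded members of a thin set are coded below every element of the club `C`. -/
theorem pi_symm_lt_of_mem_clubC (hY : Y ⊆ POmega1) (hYthin : IsThin Y) {δ ζ : Ordinal.{0}}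
    (hδ : δ ∈ clubC S) (hζ : ζ < δ) {a : Set Ordinal.{0}} (ha : a ∈ Y) (haζ : a ⊆ Set.Iio ζ)
    (hH : setCode a ∈ HOmega2) : (π.symm ⟨setCode a, hH⟩).1 < δ := by
  have hζ2 := hζ.trans hδ.1
  obtain ⟨η, hη, hs⟩ := exists_lt_omega_two_subset_Iio (fun α h => h.1)
    (mk_codes_le (π := π) hY hYthin hζ2)
  obtain ⟨z, hz, hz'⟩ := mem_Sk.1 (toZFSet_mem_Sk (S := S) hζ2 (a := Set.Iio δ) hζ)
  have hsub : ∀ (x : SideModel π Y), x.toSet ⊆ ζ.toZFSet ↔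
      ∀ u : SideModel π Y, u.toSet ∈ x.toSet → u.toSet ∈ z.toSet := fun x => by
    rw [hz']
    exact ⟨fun h u hu => h hu, fun h u hu => h ⟨u, mem_HOmega2_of_mem x.mem hu⟩ hu⟩
  have hcode : ∀ b ∈ Y, setCode b ⊆ ζ.toZFSet ↔ b ⊆ Set.Iio ζ := by
    intro b hb
    constructor
    · intro h α hα
      exact Ordinal.toZFSet_mem_toZFSet_iff.1 (h ((toZFSet_mem_setCode (hY hb).1).2 hα))
    · intro h x hx
      obtain ⟨α, hα, rfl⟩ := (mem_setCode (hY hb).1).1 hx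
      exact Ordinal.toZFSet_mem_toZFSet_iff.2 (h hα)
  -- By elementarity `Sk(δ)` contains a bound for all indices of members of `Y` included in `ζ`.
  -- Being in the domain of `π` expresses that `e` is an ordinal below `ω₂`; as `δ ∈ C`, this bound
  -- is below `δ`.
  obtain ⟨e, he, ⟨_, ⟨η', he', _⟩⟩, hall⟩ :=
    DefPred.exists_mem_skSet (S := S) (a := Set.Iio δ) (n := 1)
    (R := fun v e => (∃ w : SideModel π Y,
      ∃ α : Omega2, e.toSet = α.1.toZFSet ∧ w.toSet = (π α).1) ∧ ∀ x y : SideModel π Y,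
        (∃ a ∈ Y, x.toSet = setCode a) →
        (∃ α : Omega2, y.toSet = α.1.toZFSet ∧ x.toSet = (π α).1) →
        (∀ u : SideModel π Y, u.toSet ∈ x.toSet → u.toSet ∈ (v 0).toSet) →
        y.toSet ∈ e.toSet)
    (.and (.ex (.graph (.init (.apply _)) (.apply _)))
      (.all (.all (.imp (.inY (.init (.apply _)))
        (.imp (.graph (.apply _) (.init (.apply _)))
          (.imp (.all (.imp (.mem (.apply _) (.init (.init (.apply _))))
            (.mem (.apply _) (.apply _))))
            (.mem (.apply _) (.apply _))))))))
    (x := fun _ => z) (fun _ => hz) (by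
      refine ⟨⟨_, toZFSet_mem_HOmega2 hη⟩, ⟨⟨_, (π ⟨η, hη⟩).2⟩, ⟨η, hη⟩, rfl, rfl⟩, ?_⟩
      rintro x y ⟨b, hb, hxb⟩ ⟨α, hyα, hxα⟩ hx
      rw [← hsub, hxb, hcode b hb] at hx
      rw [hyα]
      exact Ordinal.toZFSet_mem_toZFSet_iff.2 (hs ⟨α.2, b, hb, hx, hxα.symm.trans hxb⟩))
  have hη'δ : η'.1 ∈ skOrd S (Set.Iio δ) := ⟨η'.2, mem_Sk.2 ⟨e, he, he'⟩⟩
  rw [hδ.2] at hη'δ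
  have := hall ⟨_, hH⟩ ⟨_, toZFSet_mem_HOmega2 (π.symm ⟨setCode a, hH⟩).2⟩ ⟨a, ha, rfl⟩
    ⟨_, rfl, by simp⟩ ((hsub _).1 ((hcode a ha).2 haζ))
  rw [he', Ordinal.toZFSet_mem_toZFSet_iff] at this
  exact this.trans hη'δ

theorem aleph0_lt_cof_of_mem_bigLambda {β : Ordinal.{0}} (hβ : β ∈ bigLambda S) : ℵ₀ < β.cof := by
  rw [hβ.2.1]
  simp

/-- A member of `Y` bounded in `β ∈ Λ` and lying in `Sk(M)` lies in the hull of every `N` which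
includes `M ∩ β`. -/
theorem setCode_mem_Sk_of_inter_subset (hY : Y ⊆ POmega1) (hYthin : IsThin Y) {β : Ordinal.{0}}
    (hβ : β ∈ bigLambda S) {M N a : Set Ordinal.{0}} (hM : skOrd S M = M)
    (hN : M ∩ Set.Iio β ⊆ N) (ha : a ∈ Y) (haβ : a ⊆ Set.Iio β) (h : setCode a ∈ Sk S M) :
    setCode a ∈ Sk S N := by
  obtain ⟨ζ, hζ, haζ⟩ := exists_lt_inter_subset_Iio (hY ha).2 (aleph0_lt_cof_of_mem_bigLambda hβ)
  rw [Set.inter_eq_left.2 haβ] at haζ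
  obtain ⟨δ, hδ, hζδ, hδβ⟩ := hβ.2.2 ζ hζ
  -- The index of `a` is in `M` and below `δ < β`, so it is in `N`, and `Sk(N)` recovers `a` by
  -- applying `π`.
  have hH := setCode_mem_HOmega2 (hY ha)
  have h1 := pi_symm_lt_of_mem_clubC hY hYthin hδ hζδ ha haζ hH
  have h2 : (π.symm ⟨setCode a, hH⟩).1 ∈ M := hM ▸ pi_symm_mem_skOrd (S := S) (a := M) h
  have h3 := pi_mem_Sk (S := S) (a := N) (α := π.symm ⟨setCode a, hH⟩) (hN ⟨h2, h1.trans hδβ⟩)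
  simpa using h3

theorem gammaOf_eq_of_inter_eq {M N : Set Ordinal.{0}} {ξ : Ordinal.{0}}
    (h : M ∩ Set.Iio ξ = N ∩ Set.Iio ξ) : ξ ∈ gammaOf Γ M ↔ ξ ∈ gammaOf Γ N := by
  simp only [gammaOf, Set.mem_ofPred_eq, h]

theorem inter_Iio_eq_of_le {M N : Set Ordinal.{0}} {ξ β : Ordinal.{0}} (hξ : ξ ≤ β)
    (h : M ∩ Set.Iio β = N ∩ Set.Iio β) : M ∩ Set.Iio ξ = N ∩ Set.Iio ξ := by
  have hsub : Set.Iio β ∩ Set.Iio ξ = Set.Iio ξ := Set.inter_eq_right.2 (Set.Iio_subset_Iio hξ)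
  rw [← hsub, ← Set.inter_assoc, ← Set.inter_assoc, h]

/-- `β` competes in the minimum that defines `ξ`. -/
theorem le_of_mem_gammaOf {M : Set Ordinal.{0}} {ξ β : Ordinal.{0}} (hβ : β ∈ Γ)
    (h : ξ ∈ gammaOf Γ M) (hM : M ∩ Set.Iio ξ ⊆ Set.Iio β) : ξ ≤ β :=
  h.2 ⟨hβ, csSup_le' fun _ hα => le_of_lt (hM hα)⟩

theorem cmpPoint_comm (M N : Set Ordinal.{0}) : cmpPoint Γ M N = cmpPoint Γ N M := by
  rw [cmpPoint, cmpPoint, Set.inter_comm]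

/-- The union of two adequate sets is adequate, if one of them lies below some `β' ∈ Γ` at which
the traces of the members of the other are already traces at some `β ∈ Γ` below `β'`. -/
theorem Adequate.union (hY : Y ⊆ POmega1) (hYthin : IsThin Y)
    (hYinit : ClosedUnderInitialSegments Y) (hΓ : Γ ⊆ bigLambda S) {A B : Set (Set Ordinal.{0})} (hA : Adequate S Γ A)
    (hB : Adequate S Γ B) {β β' : Ordinal.{0}} (hβ : β ∈ Γ) (hβ' : β' ∈ Γ)
    (hlt : β < β') (hAβ' : ∀ M ∈ A, M ⊆ Set.Iio β')
    (htr : ∀ N ∈ B, ∃ M ∈ A, N ∩ Set.Iio β' = M ∩ Set.Iio β) : Adequate S Γ (A ∪ B) := by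
  have key : ∀ M ∈ A, ∀ N ∈ B,
      M ∩ Set.Iio (cmpPoint Γ M N) = N ∩ Set.Iio (cmpPoint Γ M N) ∨
      setCode (M ∩ Set.Iio (cmpPoint Γ M N)) ∈ Sk S N ∨
      setCode (N ∩ Set.Iio (cmpPoint Γ M N)) ∈ Sk S M := by
    intro M hM N hN
    obtain ⟨M', hM', htrN⟩ := htr N hN
    have hNβ : N ∩ Set.Iio β = M' ∩ Set.Iio β := by
      rw [← Set.inter_eq_right.2 (Set.Iio_subset_Iio hlt.le), ← Set.inter_assoc, htrN,
        Set.inter_assoc, Set.inter_eq_right.2 (Set.Iio_subset_Iio hlt.le), Set.inter_self]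
    have hβ2 : β < ω_ 2 := (hΓ hβ).1
    -- Two rounds of minimality: `M ⊆ β'` gives `ξ ≤ β'`, and then `N ∩ ξ ⊆ N ∩ β' ⊆ β` gives `ξ ≤
    -- β`.
    have hle : ∀ ξ ∈ gammaOf Γ M ∩ gammaOf Γ N, ξ ≤ β := by
      rintro ξ ⟨h1, h2⟩
      have hξ : ξ ≤ β' := le_of_mem_gammaOf hβ' h1 (Set.inter_subset_left.trans (hAβ' M hM))
      refine le_of_mem_gammaOf hβ h2 fun α hα => ?_
      exact (htrN.subset ⟨hα.1, lt_of_lt_of_le hα.2 hξ⟩).2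
    have hcmp : cmpPoint Γ M N ≤ β := csSup_le' hle
    -- Below `β` the sets `N` and `M'` agree, so every common point of `Γ_M` and `Γ_N` is also in
    -- `Γ_{M'}`.
    have hcmp' : cmpPoint Γ M N ≤ cmpPoint Γ M M' := by
      refine csSup_le' fun ξ hξ => le_csSup ⟨ω_ 2, fun x hx => (hΓ hx.1.1.1).1.le⟩ ⟨hξ.1, ?_⟩
      exact (gammaOf_eq_of_inter_eq (inter_Iio_eq_of_le (hle ξ hξ) hNβ)).1 hξ.2
    set δ := cmpPoint Γ M N with hδ
    set ε := cmpPoint Γ M M' with hε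
    have hNδ : N ∩ Set.Iio δ = M' ∩ Set.Iio δ := inter_Iio_eq_of_le hcmp hNβ
    have hcut : ∀ K : Set Ordinal.{0}, K ∩ Set.Iio ε ∩ Set.Iio δ = K ∩ Set.Iio δ := fun K => by
      rw [Set.inter_assoc, Set.inter_eq_right.2 (Set.Iio_subset_Iio hcmp')]
    have hP : ∀ K ∈ A, K ∩ Set.Iio ε ∈ POmega1 := fun K hK =>
      ⟨Set.inter_subset_left.trans (hY (hA.1 hK).1).1,
        (hY (hA.1 hK).1).2.mono Set.inter_subset_left⟩
    rcases hA.2 M hM M' hM' with h | h | h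
    · exact Or.inl ((inter_Iio_eq_of_le hcmp' h).trans hNδ.symm)
    · refine Or.inr (Or.inl ?_)
      have h' := setCode_inter_Iio_mem_Sk (hP M hM) h δ
      rw [hcut] at h'
      refine setCode_mem_Sk_of_inter_subset hY hYthin (hΓ hβ) (hA.1 hM').2.1
        (hNβ.symm.subset.trans Set.inter_subset_left)
        (hYinit M (hA.1 hM).1 δ (hcmp.trans_lt hβ2)) ?_ h'
      exact Set.inter_subset_right.trans (Set.Iio_subset_Iio hcmp)
    · refine Or.inr (Or.inr ?_)
      have h' := setCode_inter_Iio_mem_Sk (hP M' hM') h δ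
      rwa [hcut, ← hNδ] at h'
  refine ⟨Set.union_subset hA.1 hB.1, ?_⟩
  rintro M (hM | hM) N (hN | hN)
  · exact hA.2 M hM N hN
  · exact key M hM N hN
  · rw [cmpPoint_comm]
    rcases key N hN M hM with h | h | h
    exacts [Or.inl h.symm, Or.inr (Or.inr h), Or.inr (Or.inl h)]
  · exact hB.2 M hM N hN

end Adequate
/-! ### Pressing down -/

theorem mk_Iio_le_aleph_one {y : Ordinal.{0}} (hy : y < ω_ 2) : #(Set.Iio y) ≤ ℵ_ 1 := by
  rw [Cardinal.mk_Iio_ordinal]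
  have h : y.card < ℵ_ 2 := Cardinal.lt_ord.1 (by simpa using hy)
  rw [← one_add_one_eq_two, ← Cardinal.succ_aleph, Order.lt_succ_iff] at h
  simpa using Cardinal.lift_le.{1}.2 h

theorem Omega2.exists_forall_lt {s : Set Omega2} (hs : #s ≤ ℵ_ 1) :
    ∃ η : Omega2, ∀ x ∈ s, x < η := by
  obtain ⟨η, hη, h⟩ := exists_lt_omega_two_subset_Iio (s := Subtype.val '' s)
    (by rintro _ ⟨x, _, rfl⟩; exact x.2) (Cardinal.mk_image_le.trans hs)
  exact ⟨⟨η, hη⟩, fun x hx => h ⟨x, hx, rfl⟩⟩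

theorem Omega2.mk_Iio_le (y : Omega2) : #(Set.Iio y) ≤ ℵ_ 1 := by
  refine le_trans (Cardinal.mk_le_of_injective (f := fun x : Set.Iio y =>
    (⟨x.1.1, x.2⟩ : Set.Iio y.1)) ?_) (mk_Iio_le_aleph_one y.2)
  intro a b h
  exact Subtype.ext (Subtype.ext (Subtype.mk.inj h))

/-- Unboundedness: iterate `ω` times a function `G` for which `G y` exceeds all `H ζ` with `ζ < y`,
and take the least upper bound. -/
theorem isClub_setOf_closed (H : Omega2 → Omega2) : IsClub {x : Omega2 | ∀ ζ < x, H ζ ≤ x} := by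
  refine ⟨?_, fun x₀ => ?_⟩
  · intro d hd _ _ x hx ζ hζ
    obtain ⟨y, hy, hζy⟩ := (lt_isLUB_iff hx).1 hζ
    exact (hd hy ζ hζy).trans (hx.1 hy)
  · have hG : ∀ y : Omega2, ∃ z : Omega2, ∀ ζ < y, H ζ < z := by
      intro y
      obtain ⟨z, hz⟩ := Omega2.exists_forall_lt (s := H '' Set.Iio y)
        (Cardinal.mk_image_le.trans (Omega2.mk_Iio_le y))
      exact ⟨z, fun ζ hζ => hz _ ⟨ζ, hζ, rfl⟩⟩
    choose G hG using hG
    let g : ℕ → Omega2 := fun n => G^[n] x₀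
    have hg : ∀ n, g (n + 1) = G (g n) := fun n => Function.iterate_succ_apply' G n x₀
    obtain ⟨b, hb⟩ := Omega2.exists_forall_lt (s := Set.range g) (by
      refine (Cardinal.le_aleph0_iff_set_countable.2 (Set.countable_range g)).trans ?_
      simp)
    have hne : {b : Omega2 | ∀ n, g n ≤ b}.Nonempty := ⟨b, fun n => (hb _ ⟨n, rfl⟩).le⟩
    let x := WellFounded.min (wellFounded_lt (α := Omega2)) _ hne
    have hx : ∀ n, g n ≤ x := WellFounded.min_mem (wellFounded_lt (α := Omega2)) _ hne
    refine ⟨x, fun ζ hζ => ?_, hx 0⟩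
    obtain ⟨n, hn⟩ : ∃ n, ζ < g n := by
      by_contra! hcon
      exact WellFounded.not_lt_min (wellFounded_lt (α := Omega2))
        {b : Omega2 | ∀ n, g n ≤ b} hcon hζ
    exact (hG (g n) ζ hn).le.trans (hg n ▸ hx (n + 1))

/-- If every value of `t` on a stationary set lies in a set `R ζ` of size at most `ℵ₁` with index `ζ`
below the argument, then `t` is constant on an unbounded set. -/
theorem exists_unbounded_fiber {τ : Type 1} {G : Set Omega2} (hG : IsStationary G)
    (t : Omega2 → τ) (R : Omega2 → Set τ) (hR : ∀ ζ, #(R ζ) ≤ ℵ_ 1)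
    (hreg : ∀ β ∈ G, ∃ ζ < β, t β ∈ R ζ) : ∃ c, ∀ γ, ∃ β ∈ G, γ < β ∧ t β = c := by
  by_contra! hcon
  -- `h c` bounds the fiber over `c`, and `H ζ` will bound `h` on `R ζ`. A point `β` of the
  -- stationary set closed under `H` then exceeds the bound for its own fiber.
  choose h hh using hcon
  have hH : ∀ ζ, ∃ η, ∀ x ∈ h '' R ζ, x < η := fun ζ =>
    Omega2.exists_forall_lt (Cardinal.mk_image_le.trans (hR ζ))
  choose H hH using hH
  obtain ⟨β, hβ, hcl⟩ := hG (isClub_setOf_closed H)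
  obtain ⟨ζ, hζ, htζ⟩ := hreg β hβ
  exact hh (t β) β hβ ((hH ζ _ ⟨_, htζ, rfl⟩).trans_le (hcl ζ hζ)) rfl

/-! ### Traces of conditions -/

/-- The finite subsets of a set. -/
def finiteSubsets {α : Type 1} (B : Set α) : Set (Set α) := {s | s.Finite ∧ s ⊆ B}

theorem mk_finiteSubsets_le {α : Type 1} {B : Set α} (hB : #B ≤ ℵ_ 1) :
    #(finiteSubsets B) ≤ ℵ_ 1 := by
  have h1 : #(Finset B) ≤ ℵ_ 1 := by
    rcases finite_or_infinite B with h | h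
    · have : Finite (Finset B) := inferInstance
      exact Cardinal.mk_le_aleph0.trans (by simp)
    · rwa [Cardinal.mk_finset_of_infinite]
  refine le_trans (Cardinal.mk_le_mk_of_subset ?_)
    ((Cardinal.mk_range_le (f := fun s : Finset B => Subtype.val '' (s : Set B))).trans h1)
  rintro s ⟨hs, hsB⟩
  refine ⟨(hs.preimage Subtype.val_injective.injOn).toFinset, ?_⟩
  simpa using hsB

theorem mk_prod_le_aleph_one {α β : Type 1} {s : Set α} {t : Set β} (hs : #s ≤ ℵ_ 1)
    (ht : #t ≤ ℵ_ 1) : #(s ×ˢ t : Set (α × β)) ≤ ℵ_ 1 := by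
  rw [Cardinal.mk_setProd]
  exact (mul_le_mul' hs ht).trans_eq (Cardinal.mul_eq_self (Cardinal.aleph0_le_aleph 1))

variable {π : Omega2 ≃ HOmega2} {Y : Set (Set Ordinal.{0})} {S : SkolemFunctions π Y}
  {Γ : Set Ordinal.{0}}

theorem FinTree.finite_isMaximal (T : FinTree) : Finite {a // T.IsMaximal a} :=
  Finite.of_injective (β := T.carrier) (fun a => ⟨a.1, a.2.1⟩)
    fun _ _ h => Subtype.ext (Subtype.mk.inj h)

namespace KurepaCond

/-- The graph of the function `F` of a condition. -/
def graph (p : KurepaCond S Γ) : Set (Ordinal.{0} × Ordinal.{0}) :=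
  Set.range fun a : {a // p.T.IsMaximal a} => (a.1, (p.F a).1)

theorem graph_finite (p : KurepaCond S Γ) : p.graph.Finite :=
  have := p.T.finite_isMaximal
  Set.finite_range _

/-- The ordinals below `ω₂` occurring in a condition. -/
def support (p : KurepaCond S Γ) : Set Ordinal.{0} := Prod.snd '' p.graph ∪ ⋃₀ p.A

theorem support_subset (hY : Y ⊆ POmega1) (p : KurepaCond S Γ) : p.support ⊆ Set.Iio (ω_ 2) := by
  rintro α (⟨_, ⟨a, rfl⟩, rfl⟩ | ⟨M, hM, hα⟩)
  · exact (p.F a).2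
  · exact (hY (p.adequate.1 hM).1).1 hα

theorem support_countable (hY : Y ⊆ POmega1) (p : KurepaCond S Γ) : p.support.Countable :=
  (p.graph_finite.image _).countable.union
    (p.finite.countable.sUnion fun _ hM => (hY (p.adequate.1 hM).1).2)

/-- The trace of a condition below `β`. -/
def trace (p : KurepaCond S Γ) (β : Ordinal.{0}) :
    Set Ordinal.{0} × Set (Ordinal.{0} × Ordinal.{0}) × Set (Ordinal.{0} × Ordinal.{0}) ×
      Set (Set Ordinal.{0}) :=
  (p.T.carrier, {x | p.T.lt x.1 x.2}, p.graph ∩ {x | x.2 < β}, (· ∩ Set.Iio β) '' p.A)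

/-- The possible traces of conditions bounded by `ζ`. -/
def traces (Y : Set (Set Ordinal.{0})) (ζ : Ordinal.{0}) :
    Set (Set Ordinal.{0} × Set (Ordinal.{0} × Ordinal.{0}) × Set (Ordinal.{0} × Ordinal.{0}) ×
      Set (Set Ordinal.{0})) :=
  finiteSubsets (Set.Iio (ω_ 1)) ×ˢ finiteSubsets (Set.Iio (ω_ 1) ×ˢ Set.Iio (ω_ 1)) ×ˢ
    finiteSubsets (Set.Iio (ω_ 1) ×ˢ Set.Iio ζ) ×ˢ finiteSubsets ((· ∩ Set.Iio ζ) '' Y)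

theorem mk_traces_le (hYthin : IsThin Y) {ζ : Ordinal.{0}} (hζ : ζ < ω_ 2) :
    #(traces Y ζ) ≤ ℵ_ 1 := by
  have h1 : #(Set.Iio (ω_ 1 : Ordinal.{0})) ≤ ℵ_ 1 :=
    mk_Iio_le_aleph_one (Ordinal.omega_lt_omega.2 (by norm_num))
  exact mk_prod_le_aleph_one (mk_finiteSubsets_le h1)
    (mk_prod_le_aleph_one (mk_finiteSubsets_le (mk_prod_le_aleph_one h1 h1))
      (mk_prod_le_aleph_one
        (mk_finiteSubsets_le (mk_prod_le_aleph_one h1 (mk_Iio_le_aleph_one hζ)))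
        (mk_finiteSubsets_le (hYthin ζ hζ))))

/-- Nothing in the support lies in `[ζ, β)`, so cutting at `β` and cutting at `ζ` give the same
result. -/
theorem trace_mem_traces (p : KurepaCond S Γ) {β ζ : Ordinal.{0}} (hζ : ζ ≤ β)
    (h : p.support ∩ Set.Iio β ⊆ Set.Iio ζ) : p.trace β ∈ traces Y ζ := by
  refine ⟨⟨Finset.finite_toSet _, p.T.carrier_lt⟩, ⟨?_, ?_⟩, ⟨p.graph_finite.inter_of_left _, ?_⟩,
    p.finite.image _, ?_⟩
  · refine (((Finset.finite_toSet p.T.carrier).prod (Finset.finite_toSet p.T.carrier))).subset ?_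
    exact fun x hx => p.T.lt_mem _ _ hx
  · exact fun x hx => ⟨p.T.carrier_lt _ (p.T.lt_mem _ _ hx).1,
      p.T.carrier_lt _ (p.T.lt_mem _ _ hx).2⟩
  · rintro _ ⟨⟨a, rfl⟩, hx⟩
    exact ⟨p.T.carrier_lt _ a.2.1, h ⟨Or.inl ⟨_, ⟨a, rfl⟩, rfl⟩, hx⟩⟩
  · rintro _ ⟨M, hM, rfl⟩
    refine ⟨M, (p.adequate.1 hM).1, ?_⟩
    ext α
    exact ⟨fun hα => ⟨hα.1, lt_of_lt_of_le hα.2 hζ⟩,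
      fun hα => ⟨hα.1, h ⟨Or.inr ⟨M, hM, hα.1⟩, hα.2⟩⟩⟩

end KurepaCond
/-! ### Amalgamation of finite trees -/

namespace FinTree

theorem exists_le_isMaximal (T : FinTree) {x : Ordinal.{0}} (hx : x ∈ T.carrier) :
    ∃ a, T.IsMaximal a ∧ T.le x a := by
  classical
  -- The largest ordinal above `x` in the tree is a maximal node, since the tree order refines the
  -- ordinal order.
  obtain ⟨a, ha, hmax⟩ := Finset.exists_max_image (T.carrier.filter (T.le x)) id
    ⟨x, by simp [hx, le]⟩
  rw [Finset.mem_filter] at ha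
  refine ⟨a, ⟨ha.1, fun b hab => ?_⟩, ha.2⟩
  have hb : b ∈ T.carrier.filter (T.le x) := by
    rw [Finset.mem_filter]
    refine ⟨(T.lt_mem _ _ hab).2, Or.inr ?_⟩
    rcases ha.2 with rfl | h
    exacts [hab, T.trans _ _ _ h hab]
  exact (hmax b hb).not_gt (T.lt_of_lt _ _ hab)

theorem lt_of_lt_of_le {T : FinTree} {x y z : Ordinal.{0}} (h : T.lt x y) (h' : T.le y z) :
    T.lt x z := by
  rcases h' with rfl | h'
  exacts [h, T.trans _ _ _ h h']

theorem le.mem {T : FinTree} {x y : Ordinal.{0}} (h : T.le x y) (hy : y ∈ T.carrier) :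
    x ∈ T.carrier := by
  rcases h with rfl | h
  exacts [hy, (T.lt_mem _ _ h).1]

/-- The tree obtained from `T` by adding, for every `v : V`, a new node `e v` directly above
the node `h v`. -/
noncomputable def extend (T : FinTree) {V : Type} [Finite V] (h : V → Ordinal.{0})
    (hh : ∀ v, h v ∈ T.carrier) (e : V → Ordinal.{0}) (he : e.Injective) (heω : ∀ v, e v < ω_ 1)
    (heT : ∀ v, ∀ a ∈ T.carrier, a < e v) : FinTree where
  carrier := T.carrier ∪ (Set.finite_range e).toFinset
  lt x y := T.lt x y ∨ ∃ v, y = e v ∧ T.le x (h v)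
  carrier_lt := by
    intro a ha
    simp only [Finset.mem_union, Set.Finite.mem_toFinset, Set.mem_range] at ha
    rcases ha with ha | ⟨v, rfl⟩
    exacts [T.carrier_lt a ha, heω v]
  lt_mem := by
    simp only [Finset.mem_union, Set.Finite.mem_toFinset, Set.mem_range]
    rintro a b (hab | ⟨v, rfl, hav⟩)
    · exact ⟨Or.inl (T.lt_mem _ _ hab).1, Or.inl (T.lt_mem _ _ hab).2⟩
    · exact ⟨Or.inl (hav.mem (hh v)), Or.inr ⟨v, rfl⟩⟩
  irrefl := by
    rintro a (h1 | ⟨v, rfl, h1⟩)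
    · exact T.irrefl a h1
    · exact (heT v _ (h1.mem (hh v))).false
  trans := by
    rintro a b c (h1 | ⟨v, rfl, h1⟩) (h2 | ⟨w, rfl, h2⟩)
    · exact Or.inl (T.trans _ _ _ h1 h2)
    · exact Or.inr ⟨w, rfl, Or.inr (lt_of_lt_of_le h1 h2)⟩
    · exact ((heT v _ (T.lt_mem _ _ h2).1).false).elim
    · exact ((heT v _ (h2.mem (hh w))).false).elim
  comparable := by
    rintro a b c (h1 | ⟨v, rfl, h1⟩) (h2 | ⟨w, hvw, h2⟩)
    · rcases T.comparable _ _ _ h1 h2 with h | h | h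
      exacts [Or.inl h, Or.inr (Or.inl (Or.inl h)), Or.inr (Or.inr (Or.inl h))]
    · exact ((heT w _ (hvw ▸ (T.lt_mem _ _ h1).2)).false).elim
    · exact ((heT v _ (T.lt_mem _ _ h2).2).false).elim
    · obtain rfl := he hvw
      rcases h1 with rfl | h1
      · rcases h2 with rfl | h2
        exacts [Or.inl rfl, Or.inr (Or.inr (Or.inl h2))]
      · rcases h2 with rfl | h2
        · exact Or.inr (Or.inl (Or.inl h1))
        · rcases T.comparable _ _ _ h1 h2 with h | h | h
          exacts [Or.inl h, Or.inr (Or.inl (Or.inl h)), Or.inr (Or.inr (Or.inl h))]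
  lt_of_lt := by
    rintro a b (h1 | ⟨v, rfl, h1⟩)
    · exact T.lt_of_lt _ _ h1
    · exact heT v _ (h1.mem (hh v))

section Extend

variable {T : FinTree} {V : Type} [Finite V] {h : V → Ordinal.{0}}
  {hh : ∀ v, h v ∈ T.carrier} {e : V → Ordinal.{0}} {he : e.Injective} {heω : ∀ v, e v < ω_ 1}
  {heT : ∀ v, ∀ a ∈ T.carrier, a < e v}

theorem extend_lt_iff {x y : Ordinal.{0}} : (T.extend h hh e he heω heT).lt x y ↔
    T.lt x y ∨ ∃ v, y = e v ∧ T.le x (h v) := Iff.rfl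

theorem extend_lt_node_iff {x : Ordinal.{0}} {v : V} :
    (T.extend h hh e he heω heT).lt x (e v) ↔ T.le x (h v) := by
  rw [extend_lt_iff]
  constructor
  · rintro (h1 | ⟨w, hvw, h1⟩)
    · exact ((heT v _ (T.lt_mem _ _ h1).2).false).elim
    · rwa [he hvw]
  · exact fun h1 => Or.inr ⟨v, rfl, h1⟩

theorem extend_endExtends : (T.extend h hh e he heω heT).EndExtends T := by
  refine ⟨Finset.subset_union_left, fun a _ b hb => ⟨?_, Or.inl⟩⟩
  rintro (h1 | ⟨v, rfl, _⟩)
  exacts [h1, ((heT v _ hb).false).elim]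

theorem extend_isMaximal_node (v : V) : (T.extend h hh e he heω heT).IsMaximal (e v) := by
  refine ⟨by simp [extend], fun b => ?_⟩
  rintro (h1 | ⟨w, rfl, h1⟩)
  · exact (heT v _ (T.lt_mem _ _ h1).1).false
  · exact (heT v _ (h1.mem (hh w))).false

theorem exists_eq_node_of_extend_isMaximal (hcov : ∀ a, T.IsMaximal a → ∃ v, h v = a)
    {x : Ordinal.{0}} (hx : (T.extend h hh e he heω heT).IsMaximal x) : ∃ v, e v = x := by
  have hx1 := hx.1
  simp only [extend, Finset.mem_union, Set.Finite.mem_toFinset, Set.mem_range] at hx1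
  rcases hx1 with hxT | hv
  · obtain ⟨a, ha, hxa⟩ := T.exists_le_isMaximal hxT
    obtain ⟨v, rfl⟩ := hcov a ha
    exact (hx.2 (e v) (Or.inr ⟨v, rfl, hxa⟩)).elim
  · exact hv

end Extend

theorem exists_nodes (T : FinTree) (V : Type) [Countable V] : ∃ e : V → Ordinal.{0},
    e.Injective ∧ (∀ v, e v < ω_ 1) ∧ ∀ v, ∀ a ∈ T.carrier, a < e v := by
  obtain ⟨g, hg⟩ := exists_injective_nat V
  have hlim : Order.IsSuccLimit (ω_ 1 : Ordinal.{0}) := Cardinal.isSuccLimit_omega 1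
  let μ : Ordinal.{0} := T.carrier.sup (fun a => a + 1)
  have hμ : μ < ω_ 1 := by
    rw [Finset.sup_lt_iff hlim.bot_lt]
    exact fun a ha => hlim.add_one_lt (T.carrier_lt a ha)
  refine ⟨fun v => μ + (g v : Ordinal.{0}), fun v w h => ?_, fun v => ?_, fun v a ha => ?_⟩
  · exact hg (by simpa using h)
  · have : ∀ n : ℕ, μ + (n : Ordinal.{0}) < ω_ 1 := by
      intro n
      induction n with
      | zero => simpa using hμ
      | succ n ih =>
        rw [Nat.cast_succ, ← add_assoc]
        exact hlim.add_one_lt ih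
    exact this _
  · calc a < a + 1 := lt_add_one a
      _ ≤ μ := Finset.le_sup (f := fun a : Ordinal.{0} => a + 1) ha
      _ ≤ _ := le_self_add

end FinTree

/-! ### Amalgamation of conditions -/

/-- Two conditions with the same tree are compatible if the union of their side conditions is
adequate and their functions cohere. -/
theorem KurepaCond.compatible_of_graph (p q : KurepaCond S Γ) (hT : p.T = q.T)
    (had : Adequate S Γ (p.A ∪ q.A))
    (hinj : ∀ a b v, (a, v) ∈ p.graph → (b, v) ∈ q.graph → a = b)
    (hp : ∀ M ∈ p.A, ∀ a, ∀ v ∈ M, (a, v) ∈ q.graph → (a, v) ∈ p.graph)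
    (hq : ∀ M ∈ q.A, ∀ a, ∀ v ∈ M, (a, v) ∈ p.graph → (a, v) ∈ q.graph) :
    Compatible p q := by
  have hpm := p.mem_of_lt_lt
  have hqm := q.mem_of_lt_lt
  obtain ⟨T, F, A, hAf, hA, _⟩ := p
  obtain ⟨T', F', A', hAf', hA', _⟩ := q
  obtain rfl : T = T' := hT
  simp only [graph, Set.mem_range, Prod.mk.injEq] at hinj hp hq
  have := T.finite_isMaximal
  let V₁ : Set Omega2 := Set.range F ∪ Set.range F'
  have hV : V₁.Finite := (Set.finite_range _).union (Set.finite_range _)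
  obtain ⟨n, val, hval, hrange⟩ : ∃ (n : ℕ) (val : Fin n → Omega2), val.Injective ∧
      Set.range val = V₁ := by
    have := hV.to_subtype
    obtain ⟨n, ⟨E⟩⟩ := Finite.exists_equiv_fin V₁
    exact ⟨n, fun i => (E.symm i).1, Subtype.val_injective.comp E.symm.injective, by
      rw [Set.range_comp', E.symm.surjective.range_eq]; simp⟩
  obtain ⟨e, he, heω, heT⟩ := T.exists_nodes (Fin n)
  -- `h i` will be the maximal node carrying the value `val i`. By `hinj` it does not depend on
  -- which of the two functions is used.
  have hex : ∀ i, ∃ a, F a = val i ∨ F' a = val i := by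
    intro i
    have : val i ∈ V₁ := hrange ▸ ⟨i, rfl⟩
    rcases this with ⟨a, ha⟩ | ⟨a, ha⟩
    exacts [⟨a, Or.inl ha⟩, ⟨a, Or.inr ha⟩]
  choose h hh using hex
  have hF : ∀ i a, F a = val i → h i = a := by
    intro i a ha
    rcases hh i with h1 | h1
    · exact F.injective (h1.trans ha.symm)
    · exact Subtype.ext (hinj a.1 (h i).1 (val i).1 ⟨a, rfl, by rw [ha]⟩
        ⟨h i, rfl, by rw [h1]⟩).symm
  have hF' : ∀ i a, F' a = val i → h i = a := by
    intro i a ha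
    rcases hh i with h1 | h1
    · exact Subtype.ext (hinj (h i).1 a.1 (val i).1 ⟨h i, rfl, by rw [h1]⟩
        ⟨a, rfl, by rw [ha]⟩)
    · exact F'.injective (h1.trans ha.symm)
  have hsurj : ∀ a, ∃ i, val i = F a := fun a => by
    have : F a ∈ V₁ := Or.inl ⟨a, rfl⟩
    rwa [← hrange] at this
  have hsurj' : ∀ a, ∃ i, val i = F' a := fun a => by
    have : F' a ∈ V₁ := Or.inr ⟨a, rfl⟩
    rwa [← hrange] at this
  let U := T.extend (fun i => (h i).1) (fun i => (h i).2.1) e he heω heT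
  have hend : U.EndExtends T := FinTree.extend_endExtends
  have hnode : ∀ i, U.IsMaximal (e i) := FinTree.extend_isMaximal_node
  have hltnode : ∀ c i, U.lt c (e i) ↔ T.le c (h i).1 := fun _ _ => FinTree.extend_lt_node_iff
  have hmax : ∀ x : {x // U.IsMaximal x}, ∃ i, e i = x.1 := fun x =>
    FinTree.exists_eq_node_of_extend_isMaximal (fun a ha => by
      obtain ⟨i, hi⟩ := hsurj ⟨a, ha⟩
      exact ⟨i, by rw [hF i _ hi.symm]⟩) x.2
  choose idx hidx using hmax
  have hidx' : ∀ i hi, idx ⟨e i, hi⟩ = i := fun i hi => he (hidx ⟨e i, hi⟩)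
  have hinjidx : idx.Injective := fun x y hxy => Subtype.ext (by rw [← hidx x, ← hidx y, hxy])
  have hlt : ∀ (c : Ordinal.{0}) (x : {x // U.IsMaximal x}), U.lt c x.1 →
      T.le c (h (idx x)).1 := by
    intro c x hc
    rw [← hidx x] at hc
    exact (hltnode _ _).1 hc
  have hbelow : ∀ (c : Ordinal.{0}) (a b : {a // T.IsMaximal a}), a ≠ b → T.le c a.1 →
      T.le c b.1 → T.lt c a.1 ∧ T.lt c b.1 := by
    rintro c a b hab (h1 | h1) (h2 | h2)
    · exact (hab (Subtype.ext (h1.symm.trans h2))).elim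
    · exact (a.2.2 b.1 (h1 ▸ h2)).elim
    · exact (b.2.2 a.1 (h2 ▸ h1)).elim
    · exact ⟨h1, h2⟩
  let r : KurepaCond S Γ :=
    { T := U
      F := ⟨fun x => val (idx x), hval.comp hinjidx⟩
      A := A ∪ A'
      finite := hAf.union hAf'
      adequate := had
      mem_of_lt_lt := by
        rintro M (hM | hM) x y hxy hx hy c hcx hcy
        -- Values in `M` are already values of `F`, so distinct new nodes with values in `M` lie
        -- above distinct maximal nodes of `T`, and clause (4) for the first condition applies.
        · have key : ∀ i, (val i).1 ∈ M → F (h i) = val i := by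
            intro i hi
            rcases hh i with h1 | h1
            · exact h1
            · obtain ⟨a, ha, hav⟩ := hp M hM (h i).1 (val i).1 hi ⟨h i, rfl, by rw [h1]⟩
              rw [← Subtype.ext ha]
              exact Subtype.ext hav
          have hx' := key _ hx
          have hy' := key _ hy
          have hne : h (idx x) ≠ h (idx y) := fun hc =>
            hxy (hinjidx (hval (by rw [← hx', ← hy', hc])))
          have hb := hbelow c _ _ hne (hlt c x hcx) (hlt c y hcy)
          exact hpm M hM _ _ hne (by rw [hx']; exact hx) (by rw [hy']; exact hy) c hb.1 hb.2
        · have key : ∀ i, (val i).1 ∈ M → F' (h i) = val i := by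
            intro i hi
            rcases hh i with h1 | h1
            · obtain ⟨a, ha, hav⟩ := hq M hM (h i).1 (val i).1 hi ⟨h i, rfl, by rw [h1]⟩
              rw [← Subtype.ext ha]
              exact Subtype.ext hav
            · exact h1
          have hx' := key _ hx
          have hy' := key _ hy
          have hne : h (idx x) ≠ h (idx y) := fun hc =>
            hxy (hinjidx (hval (by rw [← hx', ← hy', hc])))
          have hb := hbelow c _ _ hne (hlt c x hcx) (hlt c y hcy)
          exact hqm M hM _ _ hne (by rw [hx']; exact hx) (by rw [hy']; exact hy) c hb.1 hb.2 }
  refine ⟨r, ⟨hend, Set.subset_union_left, fun a => ?_⟩,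
    ⟨hend, Set.subset_union_right, fun a => ?_⟩⟩
  · obtain ⟨i, hi⟩ := hsurj a
    refine ⟨⟨e i, hnode i⟩, Or.inr ((hltnode _ _).2 ?_), ?_⟩
    · rw [hF i a hi.symm]
      exact Or.inl rfl
    · change F a = val (idx _)
      rw [hidx', hi]
  · obtain ⟨i, hi⟩ := hsurj' a
    refine ⟨⟨e i, hnode i⟩, Or.inr ((hltnode _ _).2 ?_), ?_⟩
    · rw [hF' i a hi.symm]
      exact Or.inl rfl
    · change F' a = val (idx _)
      rw [hidx', hi]

/-- Conditions with the same trace, the second one above the first one, are compatible. -/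
theorem KurepaCond.compatible_of_trace_eq (hY : Y ⊆ POmega1) (hYthin : IsThin Y)
    (hYinit : ClosedUnderInitialSegments Y) (hΓ : Γ ⊆ bigLambda S) (p q : KurepaCond S Γ)
    {β β' : Ordinal.{0}} (hβ : β ∈ Γ) (hβ' : β' ∈ Γ) (hlt : β < β')
    (hp : p.support ⊆ Set.Iio β') (htr : p.trace β = q.trace β') : Compatible p q := by
  simp only [trace, Prod.mk.injEq, Finset.coe_inj] at htr
  obtain ⟨hc, hl, hg, hA⟩ := htr
  have hT : p.T = q.T := by
    have hl' : p.T.lt = q.T.lt := by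
      funext a b
      exact congrArg (fun s : Set (Ordinal.{0} × Ordinal.{0}) => (a, b) ∈ s) hl
    revert hc hl'
    generalize p.T = T
    generalize q.T = T'
    cases T
    cases T'
    rintro rfl rfl
    rfl
  have htrN : ∀ N ∈ q.A, ∃ M ∈ p.A, N ∩ Set.Iio β' = M ∩ Set.Iio β := by
    intro N hN
    have : N ∩ Set.Iio β' ∈ (· ∩ Set.Iio β) '' p.A := hA ▸ ⟨N, hN, rfl⟩
    obtain ⟨M, hM, e⟩ := this
    exact ⟨M, hM, e.symm⟩
  have hsupp : ∀ a v, (a, v) ∈ p.graph → v < β' := fun a v h => hp (Or.inl ⟨_, h, rfl⟩)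
  have hsuppA : ∀ M ∈ p.A, M ⊆ Set.Iio β' := fun M hM α hα => hp (Or.inr ⟨M, hM, hα⟩)
  have hqp : ∀ a v, v < β' → (a, v) ∈ q.graph → (a, v) ∈ p.graph := fun a v hv h =>
    (hg.symm.subset ⟨h, hv⟩).1
  refine compatible_of_graph p q hT (p.adequate.union hY hYthin hYinit hΓ q.adequate hβ hβ' hlt
    hsuppA htrN) ?_ ?_ ?_
  · intro a b v ha hb
    obtain ⟨x, hx⟩ := ha
    obtain ⟨y, hy⟩ := hqp b v (hsupp a v ⟨x, hx⟩) hb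
    simp only [Prod.mk.injEq] at hx hy
    rw [← hx.1, ← hy.1, p.F.injective (Subtype.ext (hx.2.trans hy.2.symm))]
  · exact fun M hM a v hv h => hqp a v (hsuppA M hM hv) h
  · intro N hN a v hv h
    obtain ⟨M, hM, e⟩ := htrN N hN
    -- A value of the lower function lying in `N` is in `N ∩ β' = M ∩ β`, hence belongs to the
    -- common trace.
    have hvβ : v < β := (e.subset ⟨hv, hsupp a v h⟩).2
    exact (hg.subset ⟨h, hvβ⟩).1

/-! ### The chain condition -/

theorem mk_Omega2 : #Omega2 = ℵ_ 2 := by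
  rw [Cardinal.mk_Iio_ordinal]
  simp

end AdequateKurepa

theorem proposition7p10
    (hpow : (2 : Cardinal.{0}) ^ (ℵ_ 1 : Cardinal.{0}) = ℵ_ 2)
    (π : AdequateKurepa.Omega2 ≃ AdequateKurepa.HOmega2)
    (Y : Set (Set Ordinal.{0}))
    (hYstat : AdequateKurepa.IsStationaryPOmega1 Y)
    (hYthin : AdequateKurepa.IsThin Y)
    (hYinit : AdequateKurepa.ClosedUnderInitialSegments Y)
    (S : AdequateKurepa.SkolemFunctions π Y)
    (Γ : Set Ordinal.{0})
    (hΓ : Γ ⊆ AdequateKurepa.bigLambda S)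
    (hΓstat : IsStationary {x : AdequateKurepa.Omega2 | x.1 ∈ Γ}) :
    AdequateKurepa.Omega2CC (AdequateKurepa.KurepaCond S Γ) := by
  open AdequateKurepa in
  intro D hD
  by_contra! hcard
  rw [← mk_Omega2] at hcard
  obtain ⟨f⟩ := hcard
  let p : Omega2 → KurepaCond S Γ := fun β => (f β).1
  have hY := hYstat.1
  obtain ⟨t, ht⟩ := exists_unbounded_fiber hΓstat (fun β => (p β).trace β.1)
    (fun ζ => KurepaCond.traces Y ζ.1) (fun ζ => KurepaCond.mk_traces_le hYthin ζ.2) (by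
      intro β hβ
      obtain ⟨ζ, hζ, hsub⟩ := exists_lt_inter_subset_Iio ((p β).support_countable hY)
        (aleph0_lt_cof_of_mem_bigLambda (hΓ hβ))
      exact ⟨⟨ζ, hζ.trans β.2⟩, hζ, (p β).trace_mem_traces hζ.le hsub⟩)
  obtain ⟨β, hβ, -, hβt⟩ := ht ⟨0, Ordinal.omega_pos 2⟩
  obtain ⟨η, hη, hsupp⟩ := exists_lt_omega_two_subset_Iio ((p β).support_subset hY)
    ((Cardinal.le_aleph0_iff_set_countable.2 ((p β).support_countable hY)).trans (by simp))
  -- The second index is above both `β` and the whole support of `p β`.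
  obtain ⟨β', hβ', hlt, hβt'⟩ := ht (max β ⟨η, hη⟩)
  have hββ' : β < β' := (le_max_left _ _).trans_lt hlt
  have hηβ' : η < β'.1 := lt_of_le_of_lt (le_max_right β (⟨η, hη⟩ : Omega2)) hlt
  refine hD (p β) (f β).2 (p β') (f β').2 (fun h => hββ'.ne (f.injective (Subtype.ext h))) ?_
  exact KurepaCond.compatible_of_trace_eq hY hYthin hYinit hΓ (p β) (p β') hβ hβ' hββ'
    (hsupp.trans (Set.Iio_subset_Iio hηβ'.le)) (hβt.trans hβt'.symm)
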